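/- Let $G$ be a countable group. A unitary representation $\pi$ of $G$ on a complex Hilbert space $H$ is viewed as a two-sorted structure $(H,\pi)=(H,\mathbb C,+,\cdot,\langle\cdot,\cdot\rangle,\pi(g):g\in G)$, where the scalar sort $\mathbb C$ carries its ring operations and constants for the rational numbers. Positive bounded $L_G$-formulas are built from the atomic formulas $\mathrm{Re}\langle s,t\rangle\le p$, $\mathrm{Re}\langle s,t\rangle\ge p$, $\mathrm{Im}\langle s,t\rangle\le p$, $\mathrm{Im}\langle s,t\rangle\ge p$ ($s,t$ terms of the Hilbert space sort, $p\in\mathbb Q$) by conjunction, disjunction and bounded quantifiers $\exists x(\|x\|\le r\wedge\cdot)$, $\forall x(\|x\|\le r\to\cdot)$ over both sorts, with $r$ a positive rational. An approximation $\varphi'$ of $\varphi$ is obtained by strictly relaxing all these bounds (and strictly shrinking the ranges of the universal quantifiers, which stay positive); $(H,\pi)\models_{\mathcal A}\varphi(a)$ means that $(H,\pi)\models\varphi'(a)$ for all approximations $\varphi'$ of $\varphi$. The type $tp_G(b/B)$ of a tuple $b$ over $B\subseteq H$ is the set of all positive bounded formulas $\varphi(x)$ with parameters in $B$ such that $(H,\pi)\models_{\mathcal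 A}\varphi(b)$. $(H,\pi)$ is existentially closed if, whenever $(K,\sigma)\supseteq (H,\pi)$ is a unitary representation of $G$ on a Hilbert space, $\varphi(x,y)$ is a quantifier-free positive formula with approximation $\varphi'$, and $v$ is a finite tuple in $H$ with $(K,\sigma)\models\exists x\,\varphi(x,v)$, then $(H,\pi)\models\exists x\,\varphi'(x,v)$. Let $(H_\eta,\eta)$ be an existentially closed unitary representation of $G$, and let $T_{GA}$ be its approximate theory, i.e. the set of positive bounded sentences $\sigma$ with $(H_\eta,\eta)\models_{\mathcal A}\sigma$. Let $\kappa>2^{\aleph_0}$ be a cardinal and let $(H_\pi,\pi)$ be a unitary representation of $G$ on a Hilbert space that is a model of $T_{GA}$ (that is, $(H_\pi,\pi)\models_{\mathcal A}\sigma$ for all $\sigma\in T_{GA}$) and is $\kappa$-saturated: for every $A\subseteq H_\pi$ with $|A|<\kappa$ and every set $\Gamma(x_1,\dots,x_n)$ of positive bounded formulas with parameters in $A$, if for some $r$ every finite set of approximations of formulas in $\Gamma$ is satisfied by a tuple $b$ with all $\|b_i\|\le r$, then there is a tuple in $H_\pi$ that satisfies all formulas of $\Gamma$ in the sense of $\models_{\mathcal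 A}$. Then $(H_\pi,\pi)$ is superstable: for all $a_1,\dots,a_n\in H_\pi$, all $A\subseteq H_\pi$ and all $\varepsilon>0$, there are $b_1,\dots,b_n\in H_\pi$ and a finite $A_0\subseteq A$ such that $\|a_i-b_i\|<\varepsilon$ for all $i$ and $tp_G(b_1,\dots,b_n/A)$ does not divide over $A_0$. Here $tp_G(b/A)$ divides over $A_0$ if there are a tuple $c$ of fewer than $\kappa$ elements of $A$ and a sequence $(c_i)_{i<\omega}$, indiscernible over $A_0$, of realizations of $tp_G(c/A_0)$ in $H_\pi$ such that no tuple of $H_\pi$ realizes $\bigcup_{i<\omega}p(x,c_i)$, where $p(x,c)=tp_G(b/c)$. -/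

import Mathlib

universe u v w

namespace HilbertRep

open Cardinal

/-- Positive rational numbers, the bounds of bounded quantifiers. -/
abbrev PosRat : Type := {r : ℚ // 0 < r}

/-! ### Syntax: positive bounded formulas of the language `L_G`

`L_G` has a sort for the Hilbert space and a sort for the complex field. The free variables (or
names of parameters) of the Hilbert space sort are indexed by a type `α`; a formula in
`PBFormula G α k l` has in addition the Hilbert space variables `x_0, …, x_{k-1}` and the scalar
variables `z_0, …, z_{l-1}`. -/

mutual
/-- Terms of the Hilbert space sort. -/
inductive VTerm (G : Type w) (α : Type v) (k l : ℕ) : Type (max v w) where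
  | free (a : α)
  | bound (i : Fin k)
  | zero
  | add (s t : VTerm G α k l)
  | smul (c : STerm G α k l) (t : VTerm G α k l)
  | act (g : G) (t : VTerm G α k l)

/-- Terms of the scalar sort. -/
inductive STerm (G : Type w) (α : Type v) (k l : ℕ) : Type (max v w) where
  | bound (j : Fin l)
  | const (q : ℚ)
  | add (c d : STerm G α k l)
  | mul (c d : STerm G α k l)
  | inner (s t : VTerm G α k l)
end

/-- Positive bounded formulas. The atomic ones bound the real or the imaginary part of an inner
product of two terms by a rational number. `exV r φ` is `∃ x_k (‖x_k‖ ≤ r ∧ φ)`, `allV r φ` is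
`∀ x_k (‖x_k‖ ≤ r → φ)`, and `exS`, `allS` are the bounded quantifiers over scalars. -/
inductive PBFormula (G : Type*) (α : Type*) : ℕ → ℕ → Type _ where
  | reLe {k l : ℕ} (s t : VTerm G α k l) (p : ℚ) : PBFormula G α k l
  | reGe {k l : ℕ} (s t : VTerm G α k l) (p : ℚ) : PBFormula G α k l
  | imLe {k l : ℕ} (s t : VTerm G α k l) (p : ℚ) : PBFormula G α k l
  | imGe {k l : ℕ} (s t : VTerm G α k l) (p : ℚ) : PBFormula G α k l
  | and {k l : ℕ} (φ ψ : PBFormula G α k l) : PBFormula G α k l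
  | or {k l : ℕ} (φ ψ : PBFormula G α k l) : PBFormula G α k l
  | exV {k l : ℕ} (r : PosRat) (φ : PBFormula G α (k + 1) l) : PBFormula G α k l
  | allV {k l : ℕ} (r : PosRat) (φ : PBFormula G α (k + 1) l) : PBFormula G α k l
  | exS {k l : ℕ} (r : PosRat) (φ : PBFormula G α k (l + 1)) : PBFormula G α k l
  | allS {k l : ℕ} (r : PosRat) (φ : PBFormula G α k (l + 1)) : PBFormula G α k l

/-- Quantifier-free formulas. -/
def PBFormula.IsQF {G : Type*} {α : Type*} :
    {k l : ℕ} → PBFormula G α k l → Prop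
  | _, _, .reLe _ _ _ => True
  | _, _, .reGe _ _ _ => True
  | _, _, .imLe _ _ _ => True
  | _, _, .imGe _ _ _ => True
  | _, _, .and φ ψ => φ.IsQF ∧ ψ.IsQF
  | _, _, .or φ ψ => φ.IsQF ∧ ψ.IsQF
  | _, _, .exV _ _ => False
  | _, _, .allV _ _ => False
  | _, _, .exS _ _ => False
  | _, _, .allS _ _ => False

/-- `Approx φ φ'`: the formula `φ'` is an approximation of `φ`, that is, every condition in `φ` is
strictly relaxed (the range of a bounded existential quantifier grows, the range of a bounded
universal quantifier shrinks). -/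
inductive Approx {G : Type*} {α : Type*} :
    {k l : ℕ} → PBFormula G α k l → PBFormula G α k l → Prop where
  | reLe {k l : ℕ} {s t : VTerm G α k l} {p p' : ℚ} (h : p < p') :
      Approx (.reLe s t p) (.reLe s t p')
  | reGe {k l : ℕ} {s t : VTerm G α k l} {p p' : ℚ} (h : p' < p) :
      Approx (.reGe s t p) (.reGe s t p')
  | imLe {k l : ℕ} {s t : VTerm G α k l} {p p' : ℚ} (h : p < p') :
      Approx (.imLe s t p) (.imLe s t p')
  | imGe {k l : ℕ} {s t : VTerm G α k l} {p p' : ℚ} (h : p' < p) :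
      Approx (.imGe s t p) (.imGe s t p')
  | and {k l : ℕ} {φ ψ φ' ψ' : PBFormula G α k l} (h₁ : Approx φ φ') (h₂ : Approx ψ ψ') :
      Approx (.and φ ψ) (.and φ' ψ')
  | or {k l : ℕ} {φ ψ φ' ψ' : PBFormula G α k l} (h₁ : Approx φ φ') (h₂ : Approx ψ ψ') :
      Approx (.or φ ψ) (.or φ' ψ')
  | exV {k l : ℕ} {r r' : PosRat} {φ φ' : PBFormula G α (k + 1) l} (hr : r < r')
      (h : Approx φ φ') : Approx (.exV r φ) (.exV r' φ')
  | allV {k l : ℕ} {r r' : PosRat} {φ φ' : PBFormula G α (k + 1) l} (hr : r' < r)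
      (h : Approx φ φ') : Approx (.allV r φ) (.allV r' φ')
  | exS {k l : ℕ} {r r' : PosRat} {φ φ' : PBFormula G α k (l + 1)} (hr : r < r')
      (h : Approx φ φ') : Approx (.exS r φ) (.exS r' φ')
  | allS {k l : ℕ} {r r' : PosRat} {φ φ' : PBFormula G α k (l + 1)} (hr : r' < r)
      (h : Approx φ φ') : Approx (.allS r φ) (.allS r' φ')

/-! ### Semantics in the structure `(H, +, ⟨·,·⟩, π)`, where `π` is a unitary representation -/

section Semantics

variable {G : Type w} [Group G] {H : Type u} [NormedAddCommGroup H] [InnerProductSpace ℂ H]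

mutual
/-- Value of a term of the Hilbert space sort. -/
noncomputable def VTerm.eval (π : G →* (H ≃ₗᵢ[ℂ] H)) {α : Type*} {k l : ℕ}
    (v : α → H) (x : Fin k → H) (z : Fin l → ℂ) : VTerm G α k l → H
  | .free a => v a
  | .bound i => x i
  | .zero => 0
  | .add s t => VTerm.eval π v x z s + VTerm.eval π v x z t
  | .smul c t => (STerm.evalLift π v x z c).down • VTerm.eval π v x z t
  | .act g t => π g (VTerm.eval π v x z t)

/-- Value of a term of the scalar sort. (It is lifted to the universe of `H`, because the two
mutually recursive functions have to take values in the same universe.) -/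
noncomputable def STerm.evalLift (π : G →* (H ≃ₗᵢ[ℂ] H)) {α : Type*} {k l : ℕ}
    (v : α → H) (x : Fin k → H) (z : Fin l → ℂ) : STerm G α k l → ULift.{u} ℂ
  | .bound j => ⟨z j⟩
  | .const q => ⟨(q : ℂ)⟩
  | .add c d => ⟨(STerm.evalLift π v x z c).down + (STerm.evalLift π v x z d).down⟩
  | .mul c d => ⟨(STerm.evalLift π v x z c).down * (STerm.evalLift π v x z d).down⟩
  | .inner s t => ⟨inner ℂ (VTerm.eval π v x z s) (VTerm.eval π v x z t)⟩
end

/-- Satisfaction `(H, π) ⊨ φ`, where `v`, `x`, `z` give the values of the variables. -/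
def Sat (π : G →* (H ≃ₗᵢ[ℂ] H)) {α : Type*} (v : α → H) :
    {k l : ℕ} → PBFormula G α k l → (Fin k → H) → (Fin l → ℂ) → Prop
  | _, _, .reLe s t p, x, z => (inner ℂ (s.eval π v x z) (t.eval π v x z)).re ≤ (p : ℝ)
  | _, _, .reGe s t p, x, z => (p : ℝ) ≤ (inner ℂ (s.eval π v x z) (t.eval π v x z)).re
  | _, _, .imLe s t p, x, z => (inner ℂ (s.eval π v x z) (t.eval π v x z)).im ≤ (p : ℝ)
  | _, _, .imGe s t p, x, z => (p : ℝ) ≤ (inner ℂ (s.eval π v x z) (t.eval π v x z)).im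
  | _, _, .and φ ψ, x, z => Sat π v φ x z ∧ Sat π v ψ x z
  | _, _, .or φ ψ, x, z => Sat π v φ x z ∨ Sat π v ψ x z
  | _, _, .exV r φ, x, z =>
      ∃ w : H, ‖w‖ ≤ (r.1 : ℝ) ∧ Sat π v φ (Fin.snoc (α := fun _ => H) x w) z
  | _, _, .allV r φ, x, z =>
      ∀ w : H, ‖w‖ ≤ (r.1 : ℝ) → Sat π v φ (Fin.snoc (α := fun _ => H) x w) z
  | _, _, .exS r φ, x, z =>
      ∃ c : ℂ, ‖c‖ ≤ (r.1 : ℝ) ∧ Sat π v φ x (Fin.snoc (α := fun _ => ℂ) z c)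
  | _, _, .allS r φ, x, z =>
      ∀ c : ℂ, ‖c‖ ≤ (r.1 : ℝ) → Sat π v φ x (Fin.snoc (α := fun _ => ℂ) z c)

/-- Satisfaction of a formula all of whose free variables are indexed by `α`. -/
def Holds (π : G →* (H ≃ₗᵢ[ℂ] H)) {α : Type*} (v : α → H) (φ : PBFormula G α 0 0) : Prop :=
  Sat π v φ Fin.elim0 Fin.elim0

/-- Approximate satisfaction `⊨_𝒜`: all approximations of `φ` hold. -/
def ApproxHolds (π : G →* (H ≃ₗᵢ[ℂ] H)) {α : Type*} (v : α → H) (φ : PBFormula G α 0 0) :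
    Prop :=
  ∀ φ' : PBFormula G α 0 0, Approx φ φ' → Holds π v φ'

/-- The approximate theory `Th_𝒜(H, π)`. -/
def approxTheory (π : G →* (H ≃ₗᵢ[ℂ] H)) : Set (PBFormula G Empty 0 0) :=
  {σ | ApproxHolds π Empty.elim σ}

/-- `(H, π)` is a model of the set of sentences `T`, in the approximate semantics. -/
def IsModel (π : G →* (H ≃ₗᵢ[ℂ] H)) (T : Set (PBFormula G Empty 0 0)) : Prop :=
  ∀ σ ∈ T, ApproxHolds π Empty.elim σ

/-- The type `tp_G(b / B)` of a tuple `b`: all positive bounded `L_G`-formulas with parameters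
in `B` that `b` satisfies approximately. -/
def tpG (π : G →* (H ≃ₗᵢ[ℂ] H)) (B : Set H) {ι : Type*} (b : ι → H) :
    Set (PBFormula G (B ⊕ ι) 0 0) :=
  {φ | ApproxHolds π (Sum.elim (fun a : B => (a : H)) b) φ}

/-- The sequence of tuples `c 0, c 1, …` is indiscernible over `B`. -/
def IsIndiscernible (π : G →* (H ≃ₗᵢ[ℂ] H)) (B : Set H) {ι : Type*} (c : ℕ → ι → H) : Prop :=
  ∀ (m : ℕ) (s t : Fin m → ℕ), StrictMono s → StrictMono t →
    tpG π B (fun q : Fin m × ι => c (s q.1) q.2) = tpG π B (fun q : Fin m × ι => c (t q.1) q.2)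

/-- For a tuple `c`, let `p(x, y)` be the set of formulas that `(b, c)` satisfies approximately, so
that `p(x, c) = tp_G(b / c)`. This type divides over `B` if there is a `B`-indiscernible sequence
`(c_i)` of realizations of `tp_G(c / B)` such that no tuple of `H` realizes `⋃ i, p(x, c_i)`. (It
is used in saturated structures, where inconsistent sets of formulas over few parameters are
those that are not realized.) -/
def TupleTypeDivides (π : G →* (H ≃ₗᵢ[ℂ] H)) (B : Set H) {n : ℕ} (b : Fin n → H)
    {ι : Type*} (c : ι → H) : Prop :=
  ∃ cs : ℕ → ι → H, IsIndiscernible π B cs ∧ (∀ i, tpG π B (cs i) = tpG π B c) ∧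
    ¬ ∃ b' : Fin n → H, ∀ i, ∀ φ : PBFormula G (Fin n ⊕ ι) 0 0,
      ApproxHolds π (Sum.elim b c) φ → ApproxHolds π (Sum.elim b' (cs i)) φ

end Semantics

section Notions

variable {G : Type w} [Group G] {H : Type u} [NormedAddCommGroup H] [InnerProductSpace ℂ H]

/-- `(H, π)` is existentially closed: if a quantifier-free formula with parameters in `H` is
satisfied by some elements of a unitary representation `(K, σ)` on a Hilbert space extending
`(H, π)`, then each of its approximations is satisfied by some elements of `(H, π)`. -/
def IsExistentiallyClosed (π : G →* (H ≃ₗᵢ[ℂ] H)) : Prop :=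
  ∀ (K : Type u) [NormedAddCommGroup K] [InnerProductSpace ℂ K] [CompleteSpace K]
    (σ : G →* (K ≃ₗᵢ[ℂ] K)) (j : H →ₗᵢ[ℂ] K), (∀ g v, j (π g v) = σ g (j v)) →
  ∀ (n k l : ℕ) (v : Fin n → H) (φ φ' : PBFormula G (Fin n) k l), φ.IsQF → Approx φ φ' →
    (∃ (x : Fin k → K) (z : Fin l → ℂ), Sat σ (fun i => j (v i)) φ x z) →
    ∃ (x : Fin k → H) (z : Fin l → ℂ), Sat π v φ' x z

/-- `(H, π)` is `κ`-saturated: whenever `Γ` is a set of positive bounded formulas in finitely many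
variables with fewer than `κ` parameters, and every finite set of approximations of formulas
in `Γ` is satisfied in `H` by a tuple from a fixed ball, then `Γ` is realized in `H`. -/
def IsSaturated (π : G →* (H ≃ₗᵢ[ℂ] H)) (κ : Cardinal.{u}) : Prop :=
  ∀ A : Set H, #A < κ → ∀ (n : ℕ) (Γ : Set (PBFormula G (A ⊕ Fin n) 0 0)) (r : ℝ),
    (∀ Δ : Set (PBFormula G (A ⊕ Fin n) 0 0), Δ.Finite → (∀ φ' ∈ Δ, ∃ φ ∈ Γ, Approx φ φ') →
      ∃ b : Fin n → H, (∀ i, ‖b i‖ ≤ r) ∧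
        ∀ φ' ∈ Δ, Holds π (Sum.elim (fun a : A => (a : H)) b) φ') →
    ∃ b : Fin n → H, ∀ φ ∈ Γ, ApproxHolds π (Sum.elim (fun a : A => (a : H)) b) φ

/-- `tp_G(b / A)` divides over `B`: some tuple `c` of length less than `κ` of elements of `A` (for
instance an enumeration of `A`, if `A` has fewer than `κ` elements) is such that `tp_G(b / c)`
divides over `B`. -/
def TypeDivides (π : G →* (H ≃ₗᵢ[ℂ] H)) (κ : Cardinal.{u}) (A B : Set H) {n : ℕ}
    (b : Fin n → H) : Prop :=
  ∃ (ι : Type u) (c : ι → H), #ι < κ ∧ (∀ i, c i ∈ A) ∧ TupleTypeDivides π B b c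

/-- Superstability of a `κ`-saturated structure `(H, π)`. -/
def IsSuperstable (π : G →* (H ≃ₗᵢ[ℂ] H)) (κ : Cardinal.{u}) : Prop :=
  ∀ (n : ℕ) (a : Fin n → H) (A : Set H) (ε : ℝ), 0 < ε →
    ∃ (b : Fin n → H) (A₀ : Set H), A₀ ⊆ A ∧ A₀.Finite ∧ (∀ i, ‖a i - b i‖ < ε) ∧
      ¬ TypeDivides π κ A A₀ b

end Notions

end HilbertRep

namespace HilbertRep

section GramSpan

variable {G : Type*} [Group G] {H : Type*} [NormedAddCommGroup H] [InnerProductSpace ℂ H]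

/-- The families `u` and `u'` have the same inner products between all `G`-translates. -/
def GramEq (π : G →* (H ≃ₗᵢ[ℂ] H)) {J : Type*} (u u' : J → H) : Prop :=
  ∀ g i j, inner ℂ (π g (u i)) (u j) = inner ℂ (π g (u' i)) (u' j)

/-- The closed linear span of the `G`-orbits of a family. -/
def orbitSpan (π : G →* (H ≃ₗᵢ[ℂ] H)) {J : Type*} (u : J → H) : Submodule ℂ H :=
  (Submodule.span ℂ (Set.range fun p : G × J => π p.1 (u p.2))).topologicalClosure

/-- The closed linear span in `H × H` of the pairs of corresponding translates of two families. -/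
def gramSpan (π : G →* (H ≃ₗᵢ[ℂ] H)) {J : Type*} (u u' : J → H) : Submodule ℂ (H × H) :=
  (Submodule.span ℂ (Set.range fun p : G × J =>
    ((π p.1 (u p.2), π p.1 (u' p.2)) : H × H))).topologicalClosure

variable {π : G →* (H ≃ₗᵢ[ℂ] H)} {J K : Type*} {u u' : J → H} {y y' : K → H}

theorem map_mul_apply (g h : G) (x : H) : π (g * h) x = π g (π h x) := by
  rw [map_mul]; rfl

theorem inner_map_map_eq (g h : G) (x z : H) :
    inner ℂ (π g x) (π h z) = inner ℂ (π (h⁻¹ * g) x) z := by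
  have e : π g x = π h (π (h⁻¹ * g) x) := by rw [← map_mul_apply, mul_inv_cancel_left]
  rw [e, LinearIsometryEquiv.inner_map_map]

theorem inner_map_right (g : G) (x z : H) : inner ℂ x (π g z) = inner ℂ (π g⁻¹ x) z := by
  simpa using inner_map_map_eq (π := π) 1 g x z

theorem pair_mem_gramSpan (g : G) (j : J) : ((π g (u j), π g (u' j)) : H × H) ∈ gramSpan π u u' :=
  Submodule.le_topologicalClosure _ (Submodule.subset_span ⟨(g, j), rfl⟩)

theorem self_mem_gramSpan (j : J) : ((u j, u' j) : H × H) ∈ gramSpan π u u' := by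
  simpa using pair_mem_gramSpan (π := π) (u := u) (u' := u') 1 j

theorem isClosed_gramSpan : IsClosed (gramSpan π u u' : Set (H × H)) :=
  Submodule.isClosed_topologicalClosure _

theorem gramSpan_le {N : Submodule ℂ (H × H)} (hN : IsClosed (N : Set (H × H)))
    (h : ∀ g j, ((π g (u j), π g (u' j)) : H × H) ∈ N) : gramSpan π u u' ≤ N := by
  refine Submodule.topologicalClosure_minimal _ ?_ hN
  rw [Submodule.span_le]
  rintro _ ⟨p, rfl⟩
  exact h p.1 p.2

theorem act_mem_gramSpan (g : G) {p : H × H} (hp : p ∈ gramSpan π u u') :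
    ((π g p.1, π g p.2) : H × H) ∈ gramSpan π u u' := by
  let f : H × H →L[ℂ] H × H :=
    ((π g).toContinuousLinearEquiv : H →L[ℂ] H).prodMap ((π g).toContinuousLinearEquiv : H →L[ℂ] H)
  have : gramSpan π u u' ≤ (gramSpan π u u').comap f.toLinearMap := by
    refine gramSpan_le (isClosed_gramSpan.preimage f.continuous) fun h j => ?_
    have := pair_mem_gramSpan (π := π) (u := u) (u' := u') (g * h) j
    rwa [map_mul_apply, map_mul_apply] at this
  exact this hp

theorem gramSpan_mono {v v' : K → H} (h : ∀ j, ((u j, u' j) : H × H) ∈ gramSpan π v v') :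
    gramSpan π u u' ≤ gramSpan π v v' :=
  gramSpan_le isClosed_gramSpan fun g j => act_mem_gramSpan g (h j)

theorem GramEq.inner_eq (h : GramEq π u u') {p q : H × H} (hp : p ∈ gramSpan π u u')
    (hq : q ∈ gramSpan π u u') : inner ℂ p.1 q.1 = inner ℂ p.2 q.2 := by
  let N (q : H × H) : Submodule ℂ (H × H) :=
    { carrier := {p | inner ℂ p.1 q.1 = inner ℂ p.2 q.2}
      add_mem' := by
        intro a b ha hb
        simp only [Set.mem_ofPred_eq, Prod.fst_add, Prod.snd_add, inner_add_left] at *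
        rw [ha, hb]
      zero_mem' := by simp
      smul_mem' := by
        intro c a ha
        simp only [Set.mem_ofPred_eq, Prod.smul_fst, Prod.smul_snd, inner_smul_left] at *
        rw [ha] }
  have hN : ∀ q, IsClosed (N q : Set (H × H)) := fun q =>
    isClosed_eq (by fun_prop) (by fun_prop)
  have h1 : ∀ g j, ∀ p ∈ gramSpan π u u', inner ℂ p.1 (π g (u j)) = inner ℂ p.2 (π g (u' j)) := by
    intro g j p hp
    have := gramSpan_le (u := u) (u' := u') (hN (π g (u j), π g (u' j))) (fun h' i => by
      change inner ℂ (π h' (u i)) (π g (u j)) = inner ℂ (π h' (u' i)) (π g (u' j))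
      rw [inner_map_map_eq, inner_map_map_eq, h])
    exact this hp
  refine gramSpan_le (u := u) (u' := u') (hN q) (fun g j => ?_) hp
  have := h1 g j q hq
  change inner ℂ (π g (u j)) q.1 = inner ℂ (π g (u' j)) q.2
  rw [← inner_conj_symm, this, inner_conj_symm]

theorem GramEq.of_mem_gramSpan (h : GramEq π u u')
    (hy : ∀ i, ((y i, y' i) : H × H) ∈ gramSpan π u u') : GramEq π y y' :=
  fun g i j => h.inner_eq (act_mem_gramSpan g (hy i)) (hy j)

theorem GramEq.sumElim (h : GramEq π u u') (hy : GramEq π y y')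
    (ho : ∀ g k j, inner ℂ (π g (y k)) (u j) = 0) (ho' : ∀ g k j, inner ℂ (π g (y' k)) (u' j) = 0) :
    GramEq π (Sum.elim u y) (Sum.elim u' y') := by
  have flip : ∀ {a b : H}, (∀ g, inner ℂ (π g b) a = 0) → ∀ g, inner ℂ (π g a) b = 0 := by
    intro a b hab g
    rw [← inner_conj_symm, inner_map_right, hab, map_zero]
  rintro g (i | i) (j | j)
  · exact h g i j
  · exact (flip (fun g => ho g j i) g).trans (flip (fun g => ho' g j i) g).symm
  · exact (ho g i j).trans (ho' g i j).symm
  · exact hy g i j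

theorem gramSpan_le_sumElim_left : gramSpan π u u' ≤ gramSpan π (Sum.elim u y) (Sum.elim u' y') :=
  gramSpan_mono fun j => self_mem_gramSpan (u := Sum.elim u y) (u' := Sum.elim u' y') (Sum.inl j)

theorem gramSpan_le_sumElim_right : gramSpan π y y' ≤ gramSpan π (Sum.elim u y) (Sum.elim u' y') :=
  gramSpan_mono fun j => self_mem_gramSpan (u := Sum.elim u y) (u' := Sum.elim u' y') (Sum.inr j)

theorem GramEq.exists_pair_mem [CompleteSpace H] (h : GramEq π u u') {m : H}
    (hm : m ∈ orbitSpan π u) : ∃ m', ((m, m') : H × H) ∈ gramSpan π u u' := by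
  let f : gramSpan π u u' →ₗ[ℂ] H := (LinearMap.fst ℂ H H).comp (gramSpan π u u').subtype
  have hf : Isometry f := by
    refine AddMonoidHomClass.isometry_of_norm f fun p => ?_
    have e : ‖p.1.1‖ = ‖p.1.2‖ := by
      have := h.inner_eq p.2 p.2
      rw [inner_self_eq_norm_sq_to_K, inner_self_eq_norm_sq_to_K] at this
      have h2 : ‖p.1.1‖ ^ 2 = ‖p.1.2‖ ^ 2 := by exact_mod_cast this
      exact (pow_left_inj₀ (norm_nonneg _) (norm_nonneg _) two_ne_zero).1 h2
    change ‖p.1.1‖ = max ‖p.1.1‖ ‖p.1.2‖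
    rw [← e, max_self]
  have : CompleteSpace (gramSpan π u u') := isClosed_gramSpan.completeSpace_coe
  have hc : IsClosed (LinearMap.range f : Set H) := by
    rw [LinearMap.coe_range]
    exact hf.isClosedEmbedding.isClosed_range
  have hle : orbitSpan π u ≤ LinearMap.range f := by
    refine Submodule.topologicalClosure_minimal _ ?_ hc
    rw [Submodule.span_le]
    rintro _ ⟨p, rfl⟩
    exact ⟨⟨_, pair_mem_gramSpan p.1 p.2⟩, rfl⟩
  obtain ⟨⟨⟨a, b⟩, hp⟩, rfl⟩ := hle hm
  exact ⟨b, hp⟩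

theorem exists_orbitSpan_add_orthogonal [CompleteSpace H] (π : G →* (H ≃ₗᵢ[ℂ] H)) (u : J → H)
    (x : H) : ∃ m ∈ orbitSpan π u, ∃ z, x = m + z ∧ ∀ g j, inner ℂ (π g z) (u j) = 0 := by
  have : CompleteSpace (orbitSpan π u) :=
    (Submodule.isClosed_topologicalClosure _).completeSpace_coe
  obtain ⟨m, hm, z, hz, rfl⟩ := (orbitSpan π u).exists_add_mem_mem_orthogonal x
  refine ⟨m, hm, z, rfl, fun g j => ?_⟩
  have h1 : π g⁻¹ (u j) ∈ orbitSpan π u :=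
    Submodule.le_topologicalClosure _ (Submodule.subset_span ⟨(g⁻¹, j), rfl⟩)
  have h2 := (Submodule.mem_orthogonal' _ _).1 hz _ h1
  rwa [inner_map_right, inv_inv] at h2

end GramSpan

section Formulas

variable {G : Type w} {α : Type v}

/-- `n` successive bounded existential quantifiers. -/
def PBFormula.exN {k : ℕ} (r : PosRat) : (n : ℕ) → PBFormula G α (k + n) 0 → PBFormula G α k 0
  | 0, φ => φ
  | n + 1, φ => PBFormula.exN r n (.exV (k := k + n) r φ)

/-- `n` successive bounded universal quantifiers. -/
def PBFormula.allN {k : ℕ} (r : PosRat) : (n : ℕ) → PBFormula G α (k + n) 0 → PBFormula G α k 0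
  | 0, φ => φ
  | n + 1, φ => PBFormula.allN r n (.allV (k := k + n) r φ)

theorem Approx.exN {k : ℕ} {r r' : PosRat} (hr : r < r') : {n : ℕ} →
    {φ φ' : PBFormula G α (k + n) 0} → Approx φ φ' → Approx (φ.exN r n) (φ'.exN r' n)
  | 0, _, _, h => h
  | n + 1, _, _, h => Approx.exN hr (n := n) (.exV hr h)

theorem Approx.allN {k : ℕ} {r r' : PosRat} (hr : r' < r) : {n : ℕ} →
    {φ φ' : PBFormula G α (k + n) 0} → Approx φ φ' → Approx (φ.allN r n) (φ'.allN r' n)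
  | 0, _, _, h => h
  | n + 1, _, _, h => Approx.allN hr (n := n) (.allV hr h)

/-- `⟨s, t⟩` is `δ`-close to the rational complex number `q` for all `(s, t, q)` in a list. -/
def PBFormula.nearAll {k l : ℕ} (δ : ℚ) :
    List (VTerm G α k l × VTerm G α k l × ℚ × ℚ) → PBFormula G α k l
  | [] => .reLe .zero .zero δ
  | (s, t, q) :: L => .and (.and (.and (.reLe s t (q.1 + δ)) (.reGe s t (q.1 - δ)))
      (.and (.imLe s t (q.2 + δ)) (.imGe s t (q.2 - δ)))) (PBFormula.nearAll δ L)

theorem isQF_nearAll {k l : ℕ} (δ : ℚ) (L : List (VTerm G α k l × VTerm G α k l × ℚ × ℚ)) :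
    (PBFormula.nearAll δ L).IsQF := by
  induction L with
  | nil => trivial
  | cons a L ih => exact ⟨⟨⟨trivial, trivial⟩, trivial, trivial⟩, ih⟩

theorem approx_nearAll {k l : ℕ} {δ δ' : ℚ} (h : δ < δ')
    (L : List (VTerm G α k l × VTerm G α k l × ℚ × ℚ)) :
    Approx (PBFormula.nearAll δ L) (PBFormula.nearAll δ' L) := by
  induction L with
  | nil => exact .reLe h
  | cons a L ih =>
    exact .and (.and (.and (.reLe (by linarith)) (.reGe (by linarith)))
      (.and (.imLe (by linarith)) (.imGe (by linarith)))) ih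

end Formulas

theorem le_of_forall_rat_lt {a : ℝ} {p : ℚ} (h : ∀ p' : ℚ, p < p' → a ≤ p') : a ≤ p := by
  refine le_of_forall_gt fun c hc => ?_
  obtain ⟨q, hq, hqc⟩ := exists_rat_btwn hc
  exact (h q (by exact_mod_cast hq)).trans_lt hqc

theorem ge_of_forall_rat_gt {a : ℝ} {p : ℚ} (h : ∀ p' : ℚ, p' < p → (p' : ℝ) ≤ a) :
    (p : ℝ) ≤ a := by
  refine le_of_forall_lt fun c hc => ?_
  obtain ⟨q, hq, hqc⟩ := exists_rat_btwn hc
  exact hq.trans_le (h q (by exact_mod_cast hqc))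

theorem le_of_rat_le {a b : ℝ} (h : ∀ p : ℚ, a ≤ p → b ≤ p) : b ≤ a := by
  refine le_of_forall_gt fun c hc => ?_
  obtain ⟨q, hq, hqc⟩ := exists_rat_btwn hc
  exact (h q hq.le).trans_lt hqc

theorem le_of_le_rat {a b : ℝ} (h : ∀ p : ℚ, (p : ℝ) ≤ a → (p : ℝ) ≤ b) : a ≤ b := by
  refine le_of_forall_lt fun c hc => ?_
  obtain ⟨q, hq, hqc⟩ := exists_rat_btwn hc
  exact hq.trans_le (h q hqc.le)

theorem mk_range_sumElim_lt {α : Type v} {H : Type u} {κ : Cardinal.{u}}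
    (hκ : Cardinal.aleph0 ≤ κ) {v : α → H} (hv : Cardinal.mk (Set.range v) < κ) {k : ℕ}
    (x : Fin k → H) : Cardinal.mk (Set.range (Sum.elim v x)) < κ := by
  rw [Set.Sum.elim_range]
  exact (Cardinal.mk_union_le _ _).trans_lt (Cardinal.add_lt_of_lt hκ hv
    ((Cardinal.lt_aleph0_iff_set_finite.2 (Set.finite_range x)).trans_le hκ))

section Satisfaction

variable {G : Type w} [Group G] {H : Type u} [NormedAddCommGroup H] [InnerProductSpace ℂ H]
  {π : G →* (H ≃ₗᵢ[ℂ] H)} {α : Type v}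

mutual

theorem VTerm.eval_mem_gramSpan {k l : ℕ} {v v' : α → H} {x x' : Fin k → H} (z : Fin l → ℂ)
    (h : GramEq π (Sum.elim v x) (Sum.elim v' x')) : (t : VTerm G α k l) →
    ((t.eval π v x z, t.eval π v' x' z) : H × H) ∈ gramSpan π (Sum.elim v x) (Sum.elim v' x')
  | .free a => by
    rw [VTerm.eval, VTerm.eval]
    exact self_mem_gramSpan (u := Sum.elim v x) (u' := Sum.elim v' x') (Sum.inl a)
  | .bound i => by
    rw [VTerm.eval, VTerm.eval]
    exact self_mem_gramSpan (u := Sum.elim v x) (u' := Sum.elim v' x') (Sum.inr i)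
  | .zero => by
    rw [VTerm.eval, VTerm.eval]
    exact Submodule.zero_mem _
  | .add s t => by
    rw [VTerm.eval, VTerm.eval]
    exact Submodule.add_mem _ (VTerm.eval_mem_gramSpan z h s) (VTerm.eval_mem_gramSpan z h t)
  | .smul c t => by
    rw [VTerm.eval, VTerm.eval, ← STerm.evalLift_eq z h c]
    exact Submodule.smul_mem _ _ (VTerm.eval_mem_gramSpan z h t)
  | .act g t => by
    rw [VTerm.eval, VTerm.eval]
    exact act_mem_gramSpan g (VTerm.eval_mem_gramSpan z h t)

theorem STerm.evalLift_eq {k l : ℕ} {v v' : α → H} {x x' : Fin k → H} (z : Fin l → ℂ)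
    (h : GramEq π (Sum.elim v x) (Sum.elim v' x')) : (c : STerm G α k l) →
    c.evalLift π v x z = c.evalLift π v' x' z
  | .bound j => by rw [STerm.evalLift, STerm.evalLift]
  | .const q => by rw [STerm.evalLift, STerm.evalLift]
  | .add c d => by
    rw [STerm.evalLift, STerm.evalLift, STerm.evalLift_eq z h c, STerm.evalLift_eq z h d]
  | .mul c d => by
    rw [STerm.evalLift, STerm.evalLift, STerm.evalLift_eq z h c, STerm.evalLift_eq z h d]
  | .inner s t => by
    rw [STerm.evalLift, STerm.evalLift]
    exact congrArg ULift.up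
      (h.inner_eq (VTerm.eval_mem_gramSpan z h s) (VTerm.eval_mem_gramSpan z h t))

end

/-- Every vector can be adjoined to one of two families with the same inner products, with a
counterpart adjoined to the other, if the second family has fewer than `κ` members. -/
def HasExtension (π : G →* (H ≃ₗᵢ[ℂ] H)) (κ : Cardinal.{u}) : Prop :=
  ∀ (J : Type v) (u u' : J → H), Cardinal.mk (Set.range u') < κ → GramEq π u u' → ∀ w : H,
    ∃ w' : H, GramEq π (Sum.elim u fun _ : Unit => w) (Sum.elim u' fun _ : Unit => w')

theorem GramEq.symm {J : Type*} {u u' : J → H} (h : GramEq π u u') : GramEq π u' u :=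
  fun g i j => (h g i j).symm

theorem GramEq.snoc {k : ℕ} {v v' : α → H} {x x' : Fin k → H} {w w' : H}
    (h : GramEq π (Sum.elim (Sum.elim v x) fun _ : Unit => w)
      (Sum.elim (Sum.elim v' x') fun _ : Unit => w')) :
    GramEq π (Sum.elim v (Fin.snoc (α := fun _ => H) x w))
      (Sum.elim v' (Fin.snoc (α := fun _ => H) x' w')) := by
  refine h.of_mem_gramSpan ?_
  let U := Sum.elim (Sum.elim v x) fun _ : Unit => w
  let U' := Sum.elim (Sum.elim v' x') fun _ : Unit => w'
  rintro (i | i)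
  · exact self_mem_gramSpan (u := U) (u' := U') (Sum.inl (Sum.inl i))
  · refine Fin.lastCases ?_ (fun i => ?_) i
    · simp only [Sum.elim_inr, Fin.snoc_last]
      exact self_mem_gramSpan (π := π) (u := U) (u' := U') (Sum.inr ())
    · simp only [Sum.elim_inr, Fin.snoc_castSucc]
      exact self_mem_gramSpan (π := π) (u := U) (u' := U') (Sum.inl (Sum.inr i))

theorem HasExtension.sat {κ : Cardinal.{u}} (hκ : Cardinal.aleph0 ≤ κ)
    (hext : HasExtension.{u, v} π κ) {k l : ℕ} (φ : PBFormula G α k l) :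
    ∀ {v v' : α → H} {x x' : Fin k → H} (z : Fin l → ℂ), Cardinal.mk (Set.range v) < κ →
      Cardinal.mk (Set.range v') < κ → GramEq π (Sum.elim v x) (Sum.elim v' x') →
      Sat π v φ x z → Sat π v' φ x' z := by
  induction φ with
  | reLe s t p | reGe s t p | imLe s t p | imGe s t p =>
    intro v v' x x' z _ _ h hs
    have := h.inner_eq (s.eval_mem_gramSpan z h) (t.eval_mem_gramSpan z h)
    simp only [Sat] at hs ⊢
    rwa [← this]
  | and φ ψ ih₁ ih₂ =>
    intro v v' x x' z hv hv' h hs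
    exact ⟨ih₁ z hv hv' h hs.1, ih₂ z hv hv' h hs.2⟩
  | or φ ψ ih₁ ih₂ =>
    intro v v' x x' z hv hv' h hs
    exact hs.imp (ih₁ z hv hv' h) (ih₂ z hv hv' h)
  | exV r φ ih =>
    intro v v' x x' z hv hv' h ⟨a, ha, hs⟩
    obtain ⟨b, hb⟩ := hext _ _ _ (mk_range_sumElim_lt hκ hv' x') h a
    refine ⟨b, ?_, ih z hv hv' hb.snoc hs⟩
    have := hb 1 (Sum.inr ()) (Sum.inr ())
    simp only [map_one, LinearIsometryEquiv.coe_one, id, Sum.elim_inr,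
      inner_self_eq_norm_sq_to_K] at this
    have h2 : ‖a‖ ^ 2 = ‖b‖ ^ 2 := by exact_mod_cast this
    rwa [← (pow_left_inj₀ (norm_nonneg _) (norm_nonneg _) two_ne_zero).1 h2]
  | allV r φ ih =>
    intro v v' x x' z hv hv' h hs b hb
    obtain ⟨a, ha⟩ := hext _ _ _ (mk_range_sumElim_lt hκ hv x) h.symm b
    refine ih z hv hv' ha.symm.snoc (hs a ?_)
    have := ha 1 (Sum.inr ()) (Sum.inr ())
    simp only [map_one, LinearIsometryEquiv.coe_one, id, Sum.elim_inr,
      inner_self_eq_norm_sq_to_K] at this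
    have h2 : ‖b‖ ^ 2 = ‖a‖ ^ 2 := by exact_mod_cast this
    rwa [← (pow_left_inj₀ (norm_nonneg _) (norm_nonneg _) two_ne_zero).1 h2]
  | exS r φ ih =>
    intro v v' x x' z hv hv' h ⟨c, hc, hs⟩
    exact ⟨c, hc, ih _ hv hv' h hs⟩
  | allS r φ ih =>
    intro v v' x x' z hv hv' h hs c hc
    exact ih _ hv hv' h (hs c hc)

theorem sat_of_approx {k l : ℕ} {φ φ' : PBFormula G α k l} (h : Approx φ φ') {v : α → H} :
    ∀ {x : Fin k → H} {z : Fin l → ℂ}, Sat π v φ x z → Sat π v φ' x z := by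
  induction h with
  | reLe h | imLe h =>
    intro x z hs
    exact le_trans hs (by exact_mod_cast h.le)
  | reGe h | imGe h =>
    intro x z hs
    exact le_trans (by exact_mod_cast h.le) hs
  | and _ _ ih₁ ih₂ => exact fun hs => ⟨ih₁ hs.1, ih₂ hs.2⟩
  | or _ _ ih₁ ih₂ => exact fun hs => hs.imp ih₁ ih₂
  | exV hr _ ih =>
    rintro x z ⟨a, ha, hs⟩
    exact ⟨a, ha.trans (by exact_mod_cast hr.le), ih hs⟩
  | allV hr _ ih => exact fun hs a ha => ih (hs a (ha.trans (by exact_mod_cast hr.le)))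
  | exS hr _ ih =>
    rintro x z ⟨a, ha, hs⟩
    exact ⟨a, ha.trans (by exact_mod_cast hr.le), ih hs⟩
  | allS hr _ ih => exact fun hs a ha => ih (hs a (ha.trans (by exact_mod_cast hr.le)))

/-- If the value of `⟨s, t⟩` at `v` is bounded by the same rational numbers as `c`, then it is
`c`. -/
theorem inner_eq_of_approxHolds {v : α → H} {s t : VTerm G α 0 0} {c : ℂ}
    (h₁ : ∀ p : ℚ, c.re ≤ p → ApproxHolds π v (.reLe s t p))
    (h₂ : ∀ p : ℚ, (p : ℝ) ≤ c.re → ApproxHolds π v (.reGe s t p))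
    (h₃ : ∀ p : ℚ, c.im ≤ p → ApproxHolds π v (.imLe s t p))
    (h₄ : ∀ p : ℚ, (p : ℝ) ≤ c.im → ApproxHolds π v (.imGe s t p)) :
    inner ℂ (s.eval π v Fin.elim0 Fin.elim0) (t.eval π v Fin.elim0 Fin.elim0) = c :=
  Complex.ext
    (le_antisymm (le_of_rat_le fun p hp => le_of_forall_rat_lt fun _ hp' => h₁ p hp _ (.reLe hp'))
      (le_of_le_rat fun p hp => ge_of_forall_rat_gt fun _ hp' => h₂ p hp _ (.reGe hp')))
    (le_antisymm (le_of_rat_le fun p hp => le_of_forall_rat_lt fun _ hp' => h₃ p hp _ (.imLe hp'))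
      (le_of_le_rat fun p hp => ge_of_forall_rat_gt fun _ hp' => h₄ p hp _ (.imGe hp')))

theorem GramEq.of_approxHolds {v v' : α → H}
    (h : ∀ φ : PBFormula G α 0 0, ApproxHolds π v φ → ApproxHolds π v' φ) : GramEq π v v' := by
  intro g i j
  have := inner_eq_of_approxHolds (π := π) (v := v') (s := .act g (.free i)) (t := .free j)
    (c := inner ℂ (π g (v i)) (v j))
    (fun p hp => h _ fun _ ha => sat_of_approx ha (by simpa only [Sat, VTerm.eval] using hp))
    (fun p hp => h _ fun _ ha => sat_of_approx ha (by simpa only [Sat, VTerm.eval] using hp))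
    (fun p hp => h _ fun _ ha => sat_of_approx ha (by simpa only [Sat, VTerm.eval] using hp))
    (fun p hp => h _ fun _ ha => sat_of_approx ha (by simpa only [Sat, VTerm.eval] using hp))
  simpa only [VTerm.eval] using this.symm

theorem sat_exN {k : ℕ} {r : PosRat} {v : α → H} {x : Fin k → H} {z : Fin 0 → ℂ} {n : ℕ}
    {φ : PBFormula G α (k + n) 0} : Sat π v (φ.exN r n) x z ↔
      ∃ y : Fin n → H, (∀ i, ‖y i‖ ≤ (r.1 : ℝ)) ∧ Sat π v φ (Fin.append x y) z := by
  induction n with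
  | zero =>
    refine ⟨fun h => ⟨Fin.elim0, fun i => i.elim0, ?_⟩, fun ⟨y, _, h⟩ => ?_⟩
    · rw [Fin.append_elim0]; exact h
    · rw [Subsingleton.elim y Fin.elim0, Fin.append_elim0] at h; exact h
  | succ n ih =>
    refine ih.trans ⟨fun ⟨y, hy, a, ha, h⟩ => ⟨Fin.snoc (α := fun _ => H) y a, fun i => ?_, ?_⟩,
      fun ⟨y, hy, h⟩ => ⟨Fin.init y, fun i => hy _, y (Fin.last n), hy _, ?_⟩⟩
    · refine Fin.lastCases ?_ (fun i => ?_) i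
      · simpa using ha
      · simpa using hy i
    · rw [Fin.append_snoc]; exact h
    · rw [← Fin.append_snoc, Fin.snoc_init_self]; exact h

theorem sat_allN {k : ℕ} {r : PosRat} {v : α → H} {x : Fin k → H} {z : Fin 0 → ℂ} {n : ℕ}
    {φ : PBFormula G α (k + n) 0} : Sat π v (φ.allN r n) x z ↔
      ∀ y : Fin n → H, (∀ i, ‖y i‖ ≤ (r.1 : ℝ)) → Sat π v φ (Fin.append x y) z := by
  induction n with
  | zero =>
    refine ⟨fun h y _ => ?_, fun h => ?_⟩
    · rw [Subsingleton.elim y Fin.elim0, Fin.append_elim0]; exact h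
    · have := h Fin.elim0 fun i => i.elim0
      rw [Fin.append_elim0] at this; exact this
  | succ n ih =>
    refine ih.trans ⟨fun h y hy => ?_, fun h y hy a ha => ?_⟩
    · have := h (Fin.init y) (fun i => hy _) (y (Fin.last n)) (hy _)
      rw [← Fin.append_snoc, Fin.snoc_init_self] at this; exact this
    · have := h (Fin.snoc (α := fun _ => H) y a) fun i => by
        refine Fin.lastCases ?_ (fun i => ?_) i
        · simpa using ha
        · simpa using hy i
      rw [Fin.append_snoc] at this; exact this

theorem sat_nearAll {k l : ℕ} {δ : ℚ} (hδ : 0 ≤ δ) {v : α → H} {x : Fin k → H} {z : Fin l → ℂ}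
    {L : List (VTerm G α k l × VTerm G α k l × ℚ × ℚ)} :
    Sat π v (PBFormula.nearAll δ L) x z ↔ ∀ a ∈ L,
      |(inner ℂ (a.1.eval π v x z) (a.2.1.eval π v x z)).re - a.2.2.1| ≤ δ ∧
      |(inner ℂ (a.1.eval π v x z) (a.2.1.eval π v x z)).im - a.2.2.2| ≤ δ := by
  induction L with
  | nil => simpa [PBFormula.nearAll, Sat, VTerm.eval] using hδ
  | cons a L ih =>
    obtain ⟨s, t, q⟩ := a
    rw [List.forall_mem_cons, ← ih]
    simp only [PBFormula.nearAll, Sat, abs_le]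
    push_cast
    refine and_congr_left fun _ => and_congr ⟨fun h => ⟨?_, ?_⟩, fun h => ⟨?_, ?_⟩⟩
      ⟨fun h => ⟨?_, ?_⟩, fun h => ⟨?_, ?_⟩⟩ <;> linarith [h.1, h.2]

end Satisfaction

section Transfer

/-- The direct sum of two unitary representations. -/
noncomputable def prodRep {G : Type*} [Group G] {E H : Type*} [NormedAddCommGroup E]
    [InnerProductSpace ℂ E] [NormedAddCommGroup H] [InnerProductSpace ℂ H]
    (η : G →* (E ≃ₗᵢ[ℂ] E)) (π : G →* (H ≃ₗᵢ[ℂ] H)) :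
    G →* (WithLp 2 (E × H) ≃ₗᵢ[ℂ] WithLp 2 (E × H)) where
  toFun g :=
    { toLinearEquiv := ((WithLp.linearEquiv 2 ℂ (E × H)).trans
        ((η g).toLinearEquiv.prodCongr (π g).toLinearEquiv)).trans
          (WithLp.linearEquiv 2 ℂ (E × H)).symm
      norm_map' := fun x => by simp [WithLp.prod_norm_eq_of_L2] }
  map_one' := by
    ext x
    simp only [map_one]
    rfl
  map_mul' g h := by
    ext x
    simp

theorem prodRep_toLp {G : Type*} [Group G] {E H : Type*} [NormedAddCommGroup E]
    [InnerProductSpace ℂ E] [NormedAddCommGroup H] [InnerProductSpace ℂ H]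
    (η : G →* (E ≃ₗᵢ[ℂ] E)) (π : G →* (H ≃ₗᵢ[ℂ] H)) (g : G) (x : E) (y : H) :
    prodRep η π g (WithLp.toLp 2 (x, y)) = WithLp.toLp 2 (η g x, π g y) := rfl

/-- The pairs of terms `⟨π(g) x_i, v_j⟩` and `⟨π(g) x_i, x_j⟩` for `g ∈ F`, with prescribed
values. -/
noncomputable def gramList {G : Type w} {α : Type v} {k l n m : ℕ} (F : Finset G)
    (xs : Fin n → VTerm G α k l) (vs : Fin m → VTerm G α k l)
    (ρ : G → Fin n → Fin m ⊕ Fin n → ℚ × ℚ) :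
    List (VTerm G α k l × VTerm G α k l × ℚ × ℚ) :=
  (F ×ˢ (Finset.univ : Finset (Fin n × (Fin m ⊕ Fin n)))).toList.map fun p =>
    (.act p.1 (xs p.2.1), Sum.elim vs xs p.2.2, ρ p.1 p.2.1 p.2.2)

variable {G : Type w} [Group G] {H : Type u} [NormedAddCommGroup H] [InnerProductSpace ℂ H]

theorem sat_nearAll_gramList (π : G →* (H ≃ₗᵢ[ℂ] H)) {α : Type v} {k l n m : ℕ} {F : Finset G}
    {xs : Fin n → VTerm G α k l} {vs : Fin m → VTerm G α k l}
    {ρ : G → Fin n → Fin m ⊕ Fin n → ℚ × ℚ} {δ : ℚ} (hδ : 0 ≤ δ) {a : α → H} {x : Fin k → H}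
    {z : Fin l → ℂ} {y : Fin n → H} {v : Fin m → H} (hy : ∀ i, (xs i).eval π a x z = y i)
    (hv : ∀ i, (vs i).eval π a x z = v i) :
    Sat π a (PBFormula.nearAll δ (gramList F xs vs ρ)) x z ↔ ∀ g ∈ F, ∀ i e,
      |(inner ℂ (π g (y i)) (Sum.elim v y e)).re - (ρ g i e).1| ≤ δ ∧
      |(inner ℂ (π g (y i)) (Sum.elim v y e)).im - (ρ g i e).2| ≤ δ := by
  have key : ∀ e, (Sum.elim vs xs e).eval π a x z = Sum.elim v y e := by
    rintro (e | e)
    · exact hv e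
    · exact hy e
  rw [sat_nearAll hδ]
  simp only [gramList, List.mem_map, Finset.mem_toList, Finset.mem_product, Finset.mem_univ,
    and_true, Prod.exists, forall_exists_index, and_imp]
  constructor
  · intro h g hg i e
    have := h _ g i e hg rfl
    simpa only [VTerm.eval, hy, key] using this
  · rintro h _ g i e hg rfl
    simpa only [VTerm.eval, hy, key] using h g hg i e

/-- Every finite tuple has approximate copies, in a fixed ball, that are approximately orthogonal
to finitely many given vectors, where finitely many translates are taken into account. -/
def HasApproxOrthogonalCopies (π : G →* (H ≃ₗᵢ[ℂ] H)) : Prop :=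
  ∀ (n : ℕ) (b : Fin n → H), ∃ r : ℝ, ∀ (F : Finset G) (m : ℕ) (v : Fin m → H) (δ : ℚ),
    0 < δ → ∃ x : Fin n → H, (∀ i, ‖x i‖ ≤ r) ∧ ∀ g ∈ F, ∀ i,
      (∀ j, ‖inner ℂ (π g (x i)) (x j) - inner ℂ (π g (b i)) (b j)‖ ≤ δ) ∧
      ∀ j, ‖inner ℂ (π g (x i)) (v j)‖ ≤ δ

theorem exists_rat_abs_sub_le (t : ℝ) {δ : ℚ} (hδ : 0 < δ) : ∃ q : ℚ, |t - q| ≤ δ := by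
  obtain ⟨q, h₁, h₂⟩ := exists_rat_btwn (lt_add_of_pos_right t (by exact_mod_cast hδ : (0 : ℝ) < δ))
  exact ⟨q, abs_le.2 ⟨by linarith, by linarith⟩⟩

variable {E : Type u} [NormedAddCommGroup E] [InnerProductSpace ℂ E] [CompleteSpace E]
  {η : G →* (E ≃ₗᵢ[ℂ] E)} [CompleteSpace H] {π : G →* (H ≃ₗᵢ[ℂ] H)}

/-- An existentially closed representation contains approximate orthogonal copies of any finite
tuple of any representation. -/
theorem IsExistentiallyClosed.exists_near (hη : IsExistentiallyClosed η) {n m : ℕ} (b : Fin n → H)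
    (F : Finset G) {δ : ℚ} (hδ : 0 < δ) {ρ : G → Fin n → Fin m ⊕ Fin n → ℚ × ℚ}
    (hρ : ∀ g i e, |(Sum.elim (fun _ => 0) (fun j => inner ℂ (π g (b i)) (b j)) e : ℂ).re -
        (ρ g i e).1| ≤ δ ∧
      |(Sum.elim (fun _ => 0) (fun j => inner ℂ (π g (b i)) (b j)) e : ℂ).im -
        (ρ g i e).2| ≤ δ) (v : Fin m → E) :
    ∃ x : Fin n → E, ∀ g ∈ F, ∀ i e,
      |(inner ℂ (η g (x i)) (Sum.elim v x e)).re - (ρ g i e).1| ≤ (2 * δ : ℚ) ∧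
      |(inner ℂ (η g (x i)) (Sum.elim v x e)).im - (ρ g i e).2| ≤ (2 * δ : ℚ) := by
  let j : E →ₗᵢ[ℂ] WithLp 2 (E × H) :=
    { toLinearMap := (WithLp.linearEquiv 2 ℂ (E × H)).symm.toLinearMap.comp (LinearMap.inl ℂ E H)
      norm_map' := fun x => by simp }
  have hj : ∀ x, j x = WithLp.toLp 2 (x, 0) := fun _ => rfl
  let L := gramList (α := Fin m) (k := n) (l := 0) F (fun i => .bound i) (fun i => .free i) ρ
  obtain ⟨x, z, hx⟩ := hη (WithLp 2 (E × H)) (prodRep η π) j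
    (fun g v => by rw [hj, hj, prodRep_toLp, map_zero]) m n 0 v
    (PBFormula.nearAll δ L) (PBFormula.nearAll (2 * δ) L) (isQF_nearAll _ _)
    (approx_nearAll (by linarith) _)
    ⟨fun i => WithLp.toLp 2 (0, b i), Fin.elim0, by
      rw [sat_nearAll_gramList (prodRep η π) hδ.le (y := fun i => WithLp.toLp 2 (0, b i))
        (v := fun i => j (v i)) (fun i => by rw [VTerm.eval]) (fun i => by rw [VTerm.eval])]
      intro g _ i e
      have := hρ g i e
      rcases e with e | e <;> simpa [prodRep_toLp, hj] using this⟩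
  exact ⟨x, (sat_nearAll_gramList η (by linarith) (fun i => by rw [VTerm.eval])
    (fun i => by rw [VTerm.eval])).1 hx⟩

/-- Transfer of the previous statement to the models of the approximate theory. -/
theorem IsModel.hasApproxOrthogonalCopies (hη : IsExistentiallyClosed η)
    (hπ : IsModel π (approxTheory η)) : HasApproxOrthogonalCopies π := by
  intro n b
  classical
  obtain ⟨r, hr, -⟩ := exists_rat_btwn (lt_add_one (1 + ∑ i, ‖b i‖ ^ 2))
  have hr1 : (1 : ℝ) ≤ r := by
    have : 0 ≤ ∑ i, ‖b i‖ ^ 2 := Finset.sum_nonneg fun _ _ => by positivity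
    linarith
  have hr0 : 0 < r := by
    have : (0 : ℝ) < r := by linarith
    exact_mod_cast this
  refine ⟨(r + 1 : ℚ), fun F m v ε hε => ?_⟩
  obtain ⟨δ, hδ, hδ1, hδε⟩ : ∃ δ : ℚ, 0 < δ ∧ 3 * δ ≤ 1 ∧ 8 * δ ≤ ε :=
    ⟨min (1 / 3) (ε / 8), by positivity, by linarith [min_le_left (1 / 3) (ε / 8)],
      by linarith [min_le_right (1 / 3) (ε / 8)]⟩
  let τ : G → Fin n → Fin m ⊕ Fin n → ℂ := fun g i e =>
    Sum.elim (fun _ => 0) (fun j => inner ℂ (π g (b i)) (b j)) e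
  have hρ : ∀ g i e, ∃ q : ℚ × ℚ, |(τ g i e).re - q.1| ≤ δ ∧ |(τ g i e).im - q.2| ≤ δ := by
    intro g i e
    obtain ⟨q₁, h₁⟩ := exists_rat_abs_sub_le (τ g i e).re hδ
    obtain ⟨q₂, h₂⟩ := exists_rat_abs_sub_le (τ g i e).im hδ
    exact ⟨(q₁, q₂), h₁, h₂⟩
  choose ρ hρ using hρ
  obtain ⟨R, hR⟩ : ∃ R : ℚ, ∑ j, ‖v j‖ < R := exists_rat_gt _
  have hR0 : 0 < R := by
    have : 0 ≤ ∑ j, ‖v j‖ := Finset.sum_nonneg fun _ _ => norm_nonneg _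
    have : (0 : ℝ) < R := by linarith
    exact_mod_cast this
  let F' := insert 1 F
  let xs : Fin n → VTerm G Empty (0 + m + n) 0 := fun i => .bound (Fin.natAdd (0 + m) i)
  let vs : Fin m → VTerm G Empty (0 + m + n) 0 := fun j => .bound (Fin.castAdd n (Fin.natAdd 0 j))
  let φ (δ : ℚ) : PBFormula G Empty (0 + m + n) 0 := PBFormula.nearAll δ (gramList F' xs vs ρ)
  have hxs : ∀ {X : Type u} [NormedAddCommGroup X] [InnerProductSpace ℂ X]
      (θ : G →* (X ≃ₗᵢ[ℂ] X)) (y : Fin n → X) (v : Fin m → X) i, (xs i).eval θ Empty.elim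
        (Fin.append (Fin.append (Fin.elim0 : Fin 0 → X) v) y) Fin.elim0 = y i := by
    intro X _ _ θ y v i
    simp only [xs, VTerm.eval, Fin.append_right]
  have hvs : ∀ {X : Type u} [NormedAddCommGroup X] [InnerProductSpace ℂ X]
      (θ : G →* (X ≃ₗᵢ[ℂ] X)) (y : Fin n → X) (v : Fin m → X) i, (vs i).eval θ Empty.elim
        (Fin.append (Fin.append (Fin.elim0 : Fin 0 → X) v) y) Fin.elim0 = v i := by
    intro X _ _ θ y v i
    simp only [vs, VTerm.eval, Fin.append_left, Fin.append_right]
  have hE : Holds η Empty.elim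
      (((φ (2 * δ)).exN ⟨r, hr0⟩ n).allN ⟨R + 1, by linarith⟩ m) := by
    refine sat_allN.2 fun w _ => sat_exN.2 ?_
    obtain ⟨x, hx⟩ := hη.exists_near b F' hδ hρ w
    refine ⟨x, fun i => ?_,
      (sat_nearAll_gramList η (by linarith) (hxs η x w) (hvs η x w)).2 hx⟩
    have hre : ∀ {X : Type u} [NormedAddCommGroup X] [InnerProductSpace ℂ X] (a : X),
      (inner ℂ a a).re = ‖a‖ ^ 2 := fun a => inner_self_eq_norm_sq (𝕜 := ℂ) a
    have h₁ := (abs_le.1 (hx 1 (Finset.mem_insert_self _ _) i (Sum.inr i)).1).2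
    have h₂ := (abs_le.1 (hρ 1 i (Sum.inr i)).1).1
    simp only [τ, Sum.elim_inr, map_one, LinearIsometryEquiv.coe_one, id, hre]
      at h₁ h₂
    have h₃ : ‖b i‖ ^ 2 ≤ ∑ i, ‖b i‖ ^ 2 :=
      Finset.single_le_sum (f := fun i => ‖b i‖ ^ 2) (fun _ _ => by positivity)
        (Finset.mem_univ i)
    have h₄ : ‖x i‖ ^ 2 ≤ r := by
      have : (3 * δ : ℝ) ≤ 1 := by exact_mod_cast hδ1
      push_cast at h₁
      linarith
    change ‖x i‖ ≤ r
    nlinarith [norm_nonneg (x i)]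
  have hH := hπ _ (fun ψ hψ => sat_of_approx hψ hE) _
    (Approx.allN (r' := ⟨R, hR0⟩) (by exact lt_add_one R)
      (Approx.exN (r' := ⟨r + 1, by linarith⟩) (by exact lt_add_one r)
        (approx_nearAll (by linarith : 2 * δ < 3 * δ) (gramList F' xs vs ρ))))
  obtain ⟨x, hxr, hx⟩ := sat_exN.1 (sat_allN.1 hH v fun j =>
    (Finset.single_le_sum (f := fun j => ‖v j‖) (fun _ _ => norm_nonneg _)
      (Finset.mem_univ j)).trans hR.le)
  rw [sat_nearAll_gramList π (by linarith) (hxs π x v) (hvs π x v)] at hx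
  have hnear : ∀ g ∈ F, ∀ i e, ‖inner ℂ (π g (x i)) (Sum.elim v x e) - τ g i e‖ ≤ ε := by
    intro g hg i e
    obtain ⟨h₁, h₂⟩ := hx g (Finset.mem_insert_of_mem hg) i e
    obtain ⟨h₃, h₄⟩ := hρ g i e
    refine (Complex.norm_le_abs_re_add_abs_im _).trans ?_
    rw [Complex.sub_re, Complex.sub_im]
    have h₅ : (8 * δ : ℝ) ≤ ε := by exact_mod_cast hδε
    push_cast at h₁ h₂
    rw [abs_sub_comm] at h₃ h₄
    have h₆ := abs_sub_le (inner ℂ (π g (x i)) (Sum.elim v x e)).re (ρ g i e).1 (τ g i e).re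
    have h₇ := abs_sub_le (inner ℂ (π g (x i)) (Sum.elim v x e)).im (ρ g i e).2 (τ g i e).im
    linarith
  exact ⟨x, hxr, fun g hg i => ⟨fun j => hnear g hg i (Sum.inr j), fun j => by
    simpa [τ] using hnear g hg i (Sum.inl j)⟩⟩

end Transfer

section Saturation

variable {G : Type w} [Group G] {H : Type u} [NormedAddCommGroup H] [InnerProductSpace ℂ H]
  {π : G →* (H ≃ₗᵢ[ℂ] H)} {κ : Cardinal.{u}}

/-- Every finite tuple has a copy, with the same inner products between translates, that is
orthogonal to the orbits of any fewer than `κ` vectors. -/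
def HasOrthogonalCopies (π : G →* (H ≃ₗᵢ[ℂ] H)) (κ : Cardinal.{u}) : Prop :=
  ∀ (C : Set H), Cardinal.mk C < κ → ∀ (n : ℕ) (b : Fin n → H),
    ∃ y : Fin n → H, GramEq π b y ∧ ∀ g i, ∀ c ∈ C, inner ℂ (π g (y i)) c = 0

theorem IsSaturated.hasOrthogonalCopies (hsat : IsSaturated π κ)
    (happ : HasApproxOrthogonalCopies π) : HasOrthogonalCopies π κ := by
  classical
  intro C hC n b
  obtain ⟨r, hr⟩ := happ n b
  let τ : G → Fin n → C ⊕ Fin n → ℂ := fun g i e =>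
    Sum.elim (fun _ => 0) (fun j => inner ℂ (π g (b i)) (b j)) e
  let s : G → Fin n → VTerm G (C ⊕ Fin n) 0 0 := fun g i => .act g (.free (Sum.inr i))
  let t : C ⊕ Fin n → VTerm G (C ⊕ Fin n) 0 0 := fun e => .free e
  let Γ : Set (PBFormula G (C ⊕ Fin n) 0 0) := {φ | ∃ g i e, ∃ p : ℚ,
    (φ = .reLe (s g i) (t e) p ∧ (τ g i e).re ≤ p) ∨
    (φ = .reGe (s g i) (t e) p ∧ p ≤ (τ g i e).re) ∨
    (φ = .imLe (s g i) (t e) p ∧ (τ g i e).im ≤ p) ∨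
    (φ = .imGe (s g i) (t e) p ∧ p ≤ (τ g i e).im)}
  let Good (F : Finset G) (V : Finset H) (δ : ℚ) (x : Fin n → H) : Prop := ∀ g ∈ F, ∀ i,
    (∀ j, ‖inner ℂ (π g (x i)) (x j) - inner ℂ (π g (b i)) (b j)‖ ≤ δ) ∧
    ∀ v ∈ V, ‖inner ℂ (π g (x i)) v‖ ≤ δ
  let val (x : Fin n → H) : C ⊕ Fin n → H := Sum.elim (fun c : C => (c : H)) x
  have hgood : ∀ F V δ, 0 < δ → ∃ x : Fin n → H, (∀ i, ‖x i‖ ≤ r) ∧ Good F V δ x := by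
    intro F V δ hδ
    obtain ⟨x, hxr, hx⟩ := hr F _ (fun k => (V.equivFin.symm k : H)) δ hδ
    refine ⟨x, hxr, fun g hg i => ⟨(hx g hg i).1, fun v hv => ?_⟩⟩
    simpa using (hx g hg i).2 (V.equivFin ⟨v, hv⟩)
  have hclose : ∀ g (e : C ⊕ Fin n), ∃ V : Finset H, ∀ δ x, Good {g} V δ x → ∀ i,
      |(inner ℂ (π g (x i)) (val x e)).re - (τ g i e).re| ≤ δ ∧
      |(inner ℂ (π g (x i)) (val x e)).im - (τ g i e).im| ≤ δ := by
    intro g e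
    refine ⟨Sum.elim (fun c : C => {(c : H)}) (fun _ => ∅) e, fun δ x hx i => ?_⟩
    have h : ‖inner ℂ (π g (x i)) (val x e) - τ g i e‖ ≤ δ := by
      have := hx g (Finset.mem_singleton_self g) i
      rcases e with c | j
      · simpa [val, τ] using this.2 c (Finset.mem_singleton_self _)
      · exact this.1 j
    rw [← Complex.sub_re, ← Complex.sub_im]
    exact ⟨(Complex.abs_re_le_norm _).trans h, (Complex.abs_im_le_norm _).trans h⟩
  have hone : ∀ φ ∈ Γ, ∀ φ', Approx φ φ' →
      ∃ F V, ∃ δ : ℚ, 0 < δ ∧ ∀ x, Good F V δ x → Holds π (val x) φ' := by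
    rintro φ ⟨g, i, e, p, h⟩ φ' hφ
    obtain ⟨V, hV⟩ := hclose g e
    rcases h with ⟨rfl, h⟩ | ⟨rfl, h⟩ | ⟨rfl, h⟩ | ⟨rfl, h⟩ <;> cases hφ with | _ hp
    all_goals
      refine ⟨{g}, V, _, sub_pos.2 hp, fun x hx => ?_⟩
      have h₁ := abs_le.1 (hV _ x hx i).1
      have h₂ := abs_le.1 (hV _ x hx i).2
      simp only [Holds, Sat, s, t, VTerm.eval, Sum.elim_inr, val] at h₁ h₂ ⊢
      push_cast at h₁ h₂
      linarith [h₁.1, h₁.2, h₂.1, h₂.2]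
  obtain ⟨y, hy⟩ := hsat C hC n Γ r fun Δ hΔ => by
    suffices h : (∀ φ' ∈ Δ, ∃ φ ∈ Γ, Approx φ φ') → ∃ F V, ∃ δ : ℚ, 0 < δ ∧
        ∀ x, Good F V δ x → ∀ φ' ∈ Δ, Holds π (val x) φ' by
      intro hA
      obtain ⟨F, V, δ, hδ, h⟩ := h hA
      obtain ⟨x, hxr, hx⟩ := hgood F V δ hδ
      exact ⟨x, hxr, h x hx⟩
    induction Δ, hΔ using Set.Finite.induction_on with
    | empty => exact fun _ => ⟨∅, ∅, 1, one_pos, by simp⟩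
    | @insert φ' Δ _ _ ih =>
      intro hA
      obtain ⟨F, V, δ, hδ, h⟩ := ih fun ψ hψ => hA ψ (Set.mem_insert_of_mem _ hψ)
      obtain ⟨φ, hφ, hφ'⟩ := hA φ' (Set.mem_insert _ _)
      obtain ⟨F', V', δ', hδ', h'⟩ := hone φ hφ φ' hφ'
      have mono : ∀ {F₁ F₂ : Finset G} {V₁ V₂ : Finset H} {δ₁ δ₂ : ℚ} {x}, F₁ ⊆ F₂ → V₁ ⊆ V₂ →
          δ₂ ≤ δ₁ → Good F₂ V₂ δ₂ x → Good F₁ V₁ δ₁ x := by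
        intro F₁ F₂ V₁ V₂ δ₁ δ₂ x hF hV hd hx g hg i
        have hd' : (δ₂ : ℝ) ≤ δ₁ := by exact_mod_cast hd
        exact ⟨fun j => ((hx g (hF hg) i).1 j).trans hd',
          fun v hv => ((hx g (hF hg) i).2 v (hV hv)).trans hd'⟩
      refine ⟨F ∪ F', V ∪ V', min δ δ', lt_min hδ hδ', fun x hx => ?_⟩
      rintro ψ (rfl | hψ)
      · exact h' x (mono Finset.subset_union_right Finset.subset_union_right (min_le_right _ _) hx)
      · exact h x (mono Finset.subset_union_left Finset.subset_union_left (min_le_left _ _) hx) ψ hψ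
  have key : ∀ g i e, inner ℂ (π g (y i)) (val y e) = τ g i e := by
    intro g i e
    have := inner_eq_of_approxHolds (π := π) (v := val y) (s := s g i) (t := t e) (c := τ g i e)
      (fun p hp => hy _ ⟨g, i, e, p, .inl ⟨rfl, hp⟩⟩)
      (fun p hp => hy _ ⟨g, i, e, p, .inr (.inl ⟨rfl, hp⟩)⟩)
      (fun p hp => hy _ ⟨g, i, e, p, .inr (.inr (.inl ⟨rfl, hp⟩))⟩)
      (fun p hp => hy _ ⟨g, i, e, p, .inr (.inr (.inr ⟨rfl, hp⟩))⟩)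
    simp only [VTerm.eval, s, t] at this
    exact this
  exact ⟨y, fun g i j => (key g i (Sum.inr j)).symm, fun g i c hc => key g i (Sum.inl ⟨c, hc⟩)⟩

variable [CompleteSpace H]

theorem HasOrthogonalCopies.hasExtension (h : HasOrthogonalCopies π κ) :
    HasExtension.{u, v} π κ := by
  intro J u u' hu' hgram w
  obtain ⟨m, hm, z, rfl, hz⟩ := exists_orbitSpan_add_orthogonal π u w
  obtain ⟨m', hm'⟩ := hgram.exists_pair_mem hm
  obtain ⟨y, hy, hyo⟩ := h _ hu' 1 fun _ => z
  have hsum := hgram.sumElim hy (fun g _ j => hz g j) fun g i j => hyo g i _ ⟨j, rfl⟩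
  refine ⟨m' + y 0, hsum.of_mem_gramSpan ?_⟩
  rintro (j | _)
  · exact gramSpan_le_sumElim_left (self_mem_gramSpan j)
  · exact Submodule.add_mem _ (gramSpan_le_sumElim_left hm')
      (gramSpan_le_sumElim_right (self_mem_gramSpan (u := fun _ => z) (u' := y) 0))

/-- If every component of `b` is the sum of a combination of translates of elements of `B` and a
vector orthogonal to the orbits of `A`, then the type of `b` over `A` does not divide over `B`. -/
theorem HasOrthogonalCopies.not_typeDivides (h : HasOrthogonalCopies π κ)
    (hκ : Cardinal.aleph0 < κ) {A B : Set H} (hBA : B ⊆ A) (hB : B.Finite) {n : ℕ}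
    {q z : Fin n → H}
    (hq : ∀ i, q i ∈ Submodule.span ℂ (Set.range fun p : G × B => π p.1 p.2))
    (hz : ∀ g i, ∀ a ∈ A, inner ℂ (π g (z i)) a = 0) :
    ¬ TypeDivides π κ A B fun i => q i + z i := by
  rintro ⟨ι, c, hι, hcA, cs, -, htp, hno⟩
  apply hno
  have hCmk : Cardinal.mk (B ∪ Set.range fun p : ι × ℕ => cs p.2 p.1 : Set H) < κ := by
    refine (Cardinal.mk_union_le _ _).trans_lt (Cardinal.add_lt_of_lt hκ.le
      ((Cardinal.lt_aleph0_iff_set_finite.2 hB).trans hκ) (Cardinal.mk_range_le.trans_lt ?_))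
    rw [Cardinal.mk_prod, Cardinal.lift_uzero]
    exact Cardinal.mul_lt_of_lt hκ.le hι (by simpa using hκ)
  obtain ⟨y, hy, hyo⟩ := h _ hCmk n z
  refine ⟨fun i => q i + y i, fun k φ hφ φ' hφ' => ?_⟩
  let U := Sum.elim (fun a : B => (a : H)) c
  let U' := Sum.elim (fun a : B => (a : H)) (cs k)
  have hbase : GramEq π U U' :=
    GramEq.of_approxHolds fun φ hφ => (Set.ext_iff.1 (htp k) φ).2 hφ
  have hsum : GramEq π (Sum.elim U z) (Sum.elim U' y) := by
    refine hbase.sumElim hy (fun g i j => ?_) fun g i j => ?_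
    · rcases j with a | j
      · exact hz g i _ (hBA a.2)
      · exact hz g i _ (hcA j)
    · rcases j with a | j
      · exact hyo g i _ (.inl a.2)
      · exact hyo g i _ (.inr ⟨(j, k), rfl⟩)
  have hqm : ∀ i, ((q i, q i) : H × H) ∈ gramSpan π U U' := by
    intro i
    have : Submodule.span ℂ (Set.range fun p : G × B => π p.1 (p.2 : H)) ≤
        (gramSpan π U U').comap (LinearMap.id.prod LinearMap.id) := by
      rw [Submodule.span_le]
      rintro _ ⟨p, rfl⟩
      exact pair_mem_gramSpan (u := U) (u' := U') p.1 (Sum.inl p.2)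
    exact this (hq i)
  have hgram : GramEq π (Sum.elim (fun i => q i + z i) c)
      (Sum.elim (fun i => q i + y i) (cs k)) := by
    refine hsum.of_mem_gramSpan ?_
    rintro (i | j)
    · exact Submodule.add_mem _ (gramSpan_le_sumElim_left (hqm i))
        (gramSpan_le_sumElim_right (self_mem_gramSpan i))
    · exact gramSpan_le_sumElim_left (self_mem_gramSpan (u := U) (u' := U') (Sum.inr j))
  have hlt : ∀ (b : Fin n → H) (d : ι → H), Cardinal.mk (Set.range (Sum.elim b d)) < κ := by
    intro b d
    rw [Set.Sum.elim_range]
    exact (Cardinal.mk_union_le _ _).trans_lt (Cardinal.add_lt_of_lt hκ.le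
      ((Cardinal.lt_aleph0_iff_set_finite.2 (Set.finite_range b)).trans hκ)
      (Cardinal.mk_range_le.trans_lt hι))
  refine h.hasExtension.sat hκ.le φ' Fin.elim0 (hlt _ _) (hlt _ _) ?_ (hφ φ' hφ')
  intro g i j
  rcases i with i | i
  · rcases j with j | j
    · exact hgram g i j
    · exact j.elim0
  · exact i.elim0

theorem HasOrthogonalCopies.isSuperstable (h : HasOrthogonalCopies π κ)
    (hκ : Cardinal.aleph0 < κ) : IsSuperstable π κ := by
  intro n a A ε hε
  choose m hm z hz hzo using fun i =>
    exists_orbitSpan_add_orthogonal π (fun a : A => (a : H)) (a i)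
  have hq : ∀ i, ∃ q ∈ Submodule.span ℂ (Set.range fun p : G × A => π p.1 p.2), ‖m i - q‖ < ε := by
    intro i
    obtain ⟨q, hq, hd⟩ := Metric.mem_closure_iff.1 (hm i) ε hε
    exact ⟨q, hq, by rwa [← dist_eq_norm]⟩
  choose q hq hqε using hq
  have hfin : ∀ i, ∃ T : Finset (G × A),
      q i ∈ Submodule.span ℂ ((fun p : G × A => π p.1 (p.2 : H)) '' T) := by
    intro i
    obtain ⟨T, hT, hqT⟩ := Submodule.mem_span_finite_of_mem_span (hq i)
    classical
    rw [← Set.image_univ] at hT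
    obtain ⟨T', -, rfl⟩ := Finset.subset_set_image_iff.1 hT
    exact ⟨T', by simpa using hqT⟩
  choose T hT using hfin
  refine ⟨fun i => q i + z i, ⋃ i, (fun p : G × A => (p.2 : H)) '' T i, ?_, ?_, ?_, ?_⟩
  · exact Set.iUnion_subset fun i => Set.image_subset_iff.2 fun p _ => p.2.2
  · exact Set.finite_iUnion fun i => (T i).finite_toSet.image _
  · intro i
    rw [hz i, add_sub_add_right_eq_sub]
    exact hqε i
  · refine h.not_typeDivides hκ ?_ ?_ (fun i => ?_) fun g i a ha => hzo i g ⟨a, ha⟩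
    · exact Set.iUnion_subset fun i => Set.image_subset_iff.2 fun p _ => p.2.2
    · exact Set.finite_iUnion fun i => (T i).finite_toSet.image _
    · refine Submodule.span_mono ?_ (hT i)
      rintro _ ⟨p, hp, rfl⟩
      exact ⟨(p.1, ⟨p.2, Set.mem_iUnion.2 ⟨i, p, hp, rfl⟩⟩), rfl⟩

end Saturation

end HilbertRep

theorem mainTheorem6 {G : Type w} [Group G] [Countable G]
    {E : Type u} [NormedAddCommGroup E] [InnerProductSpace ℂ E] [CompleteSpace E]
    (η : G →* (E ≃ₗᵢ[ℂ] E)) (hη : HilbertRep.IsExistentiallyClosed η)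
    (κ : Cardinal.{u}) (hκ : 2 ^ Cardinal.aleph0 < κ)
    {H : Type u} [NormedAddCommGroup H] [InnerProductSpace ℂ H] [CompleteSpace H]
    (π : G →* (H ≃ₗᵢ[ℂ] H)) (hπ : HilbertRep.IsModel π (HilbertRep.approxTheory η))
    (hsat : HilbertRep.IsSaturated π κ) :
    HilbertRep.IsSuperstable π κ := by
  exact (hsat.hasOrthogonalCopies (hπ.hasApproxOrthogonalCopies hη)).isSuperstable
    ((Cardinal.cantor _).trans hκ)
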